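/- Let $\mathbf X$ be a standard Borel space and $\mathbf Z:=\mathbf X\times\mathbb R$; write $z_i=(x_i,y_i)\in\mathbf Z$, and let $U$ be the uniform distribution on $[0,1]$. **Definitions.** A *randomized predictive system* is a measurable function $Q:\bigcup_{n\ge1}(\mathbf Z^{n+1}\times[0,1])\to[0,1]$ such that for every $n\ge1$: (R1) for all $z_1,\dots,z_n\in\mathbf Z$ and $x_{n+1}\in\mathbf X$, $Q(z_1,\dots,z_n,(x_{n+1},y),\tau)$ is nondecreasing in $y$ and in $\tau$, tends to $0$ as $y\to-\infty$ when $\tau=0$, and tends to $1$ as $y\to\infty$ when $\tau=1$; (R2) for every probability measure $P$ on $\mathbf Z$, if $z_1,\dots,z_{n+1}\sim P$ and $\tau\sim U$ are independent, then $Q(z_1,\dots,z_{n+1},\tau)$ is uniformly distributed on $[0,1]$. It is *universally consistent* if for every probability measure $P$ on $\mathbf Z$ and every bounded continuous $f:\mathbb R\to\mathbb R$, $$\int f\,dQ_n-\mathbb E_P(f\mid x_{n+1})\to0\quad(n\to\infty)\ \text{in probability},$$ where $z_1,\dots,z_{n+1}\sim P$ and $\tau\sim U$ are independent, $Q_n(y):=Q(z_1,\dots,z_n,(x_{n+1},y),\tau)$,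 $\int f\,dQ_n$ is the integral with respect to the measure giving $(u,v]$ mass $Q_n(v+)-Q_n(u+)$, and $\mathbb E_P(f\mid x_{n+1})$ is the conditional expectation of $f(y)$ given $x=x_{n+1}$ under $(x,y)\sim P$. A *conformity measure* is a measurable $A:\bigcup_{n\ge1}\mathbf Z^{n+1}\to\mathbb R$ such that $A(z_1,\dots,z_n,z_{n+1})$ is invariant under permutations of $z_1,\dots,z_n$. A *taxonomy* assigns to each $(z_1,\dots,z_{n+1})\in\mathbf Z^{n+1}$, $n\ge1$, an equivalence relation $(i\sim j\mid z_1,\dots,z_{n+1})$ on $\{1,\dots,n+1\}$ such that, for all $n,i,j$, the set of sequences for which $i\sim j$ is measurable, and such that for every permutation $\pi$ with $(\pi(k)\sim k\mid z_1,\dots,z_{n+1})$ for all $k$, $(i\sim j\mid z_1,\dots,z_{n+1})$ implies $(\pi(i)\sim\pi(j)\mid z_{\pi(1)},\dots,z_{\pi(n+1)})$. The *Mondrian transducer* of a taxonomy and a conformity measure $A$ is $$Q(z_1,\dots,z_n,(x_{n+1},y),\tau):=\frac{|\{i\in\kappa:\alpha_i<\alpha_{n+1}\}|}{|\kappa|}+\tau\,\frac{|\{i\in\kappa:\alpha_i=\alpha_{n+1}\}|}{|\kappa|},\qquad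 n\ge1,$$ where, with $z_{n+1}:=(x_{n+1},y)$, $\kappa$ is the equivalence class of $n+1$ under the relation assigned to $(z_1,\dots,z_{n+1})$, and $\alpha_i:=A(z_1,\dots,z_{i-1},z_{i+1},\dots,z_{n+1},z_i)$. A *Mondrian predictive system* is a Mondrian transducer that is also a randomized predictive system. **Theorem.** There exists a universally consistent Mondrian predictive system. Moreover, let $\varphi:\mathbf X\to\mathbb R$ be any isomorphism of $\mathbf X$ onto a Borel subset of $\mathbb R$, and let $h_1\ge h_2\ge\cdots$ be any sequence of integer powers of $2$ with $h_n\to0$ and $nh_n\to\infty$. Then the histogram Mondrian predictive system, that is, the Mondrian transducer of the conformity measure $A(z_1,\dots,z_{n+1}):=y_{n+1}$ and of the taxonomy under which $(i\sim j\mid z_1,\dots,z_{n+1})$ means that $\varphi(x_i)$ and $\varphi(x_j)$ lie in the same interval $[kh_n,(k+1)h_n)$, $k\in\mathbb Z$, is a Mondrian predictive system and is universally consistent. -/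

import Mathlib

open MeasureTheory Filter Topology

namespace PredictiveSystems

noncomputable section

/-- A function of `n` training observations, a test observation `(x, y)` and a random number
`τ ∈ [0,1]`. The training set is meant to be non-empty: values at `n = 0` play no role below. -/
abbrev PredictiveFunction (X : Type*) : Type _ :=
  (n : ℕ) → (Fin n → X × ℝ) → X × ℝ → unitInterval → ℝ

/-- The joint law of `n` training observations, one test observation and a random number `τ`,
all independent, where the observations have law `P` and `τ` is uniform on `[0,1]`. -/
def jointLaw {X : Type*} [MeasurableSpace X] (P : Measure (X × ℝ)) (n : ℕ) :
    Measure ((Fin n → X × ℝ) × (X × ℝ) × unitInterval) :=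
  (Measure.pi fun _ : Fin n => P).prod (P.prod volume)

structure IsRandomizedPredictiveSystem {X : Type*} [MeasurableSpace X]
    (Q : PredictiveFunction X) : Prop where
  measurable : ∀ n, 1 ≤ n →
    Measurable fun p : (Fin n → X × ℝ) × (X × ℝ) × unitInterval => Q n p.1 p.2.1 p.2.2
  mem_Icc : ∀ n, 1 ≤ n → ∀ z w τ, Q n z w τ ∈ Set.Icc (0 : ℝ) 1
  monotone_response : ∀ n, 1 ≤ n → ∀ z x τ, Monotone fun y : ℝ => Q n z (x, y) τ
  monotone_tau : ∀ n, 1 ≤ n → ∀ z x y, Monotone fun τ : unitInterval => Q n z (x, y) τ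
  tendsto_atBot : ∀ n, 1 ≤ n → ∀ z x, Tendsto (fun y : ℝ => Q n z (x, y) 0) atBot (𝓝 0)
  tendsto_atTop : ∀ n, 1 ≤ n → ∀ z x, Tendsto (fun y : ℝ => Q n z (x, y) 1) atTop (𝓝 1)
  /-- Under any common law `P` of the observations, the output is uniform on `[0,1]`. -/
  uniform : ∀ n, 1 ≤ n → ∀ P : Measure (X × ℝ), IsProbabilityMeasure P →
    ∀ α ∈ Set.Icc (0 : ℝ) 1,
      jointLaw P n {p | Q n p.1 p.2.1 p.2.2 ≤ α} = ENNReal.ofReal α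

open Classical in
/-- The measure on `ℝ` giving mass `F(v+) - F(u+)` to `(u, v]`, for a monotone function `F`
(and, by convention, the zero measure if `F` is not monotone). -/
def predictiveMeasure (F : ℝ → ℝ) : Measure ℝ :=
  if hF : Monotone F then hF.stieltjesFunction.measure else 0

theorem predictiveMeasure_Ioc {F : ℝ → ℝ} (hF : Monotone F) (u v : ℝ) :
    predictiveMeasure F (Set.Ioc u v) =
      ENNReal.ofReal (Function.rightLim F v - Function.rightLim F u) := by
  rw [predictiveMeasure, dif_pos hF, StieltjesFunction.measure_Ioc]
  rfl

/-- Consistency for `P`: for each bounded continuous `f`, the difference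
`∫ f dQ_n - E_P(f | x_{n+1})` tends to `0` in probability. The conditional expectation of `f(y)`
given the σ-algebra generated by the predictor is evaluated at the test observation. -/
def IsConsistentFor {X : Type*} [MeasurableSpace X] (Q : PredictiveFunction X)
    (P : Measure (X × ℝ)) : Prop :=
  ∀ f : ℝ → ℝ, Continuous f → (∃ C : ℝ, ∀ y, |f y| ≤ C) → ∀ ε : ℝ, 0 < ε →
    Tendsto
      (fun n : ℕ => jointLaw P n {p | ε ≤
        |(∫ y, f y ∂(predictiveMeasure fun y => Q n p.1 (p.2.1.1, y) p.2.2)) -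
          (P[fun w : X × ℝ => f w.2 | MeasurableSpace.comap Prod.fst inferInstance]) p.2.1|})
      atTop (𝓝 0)

def IsUniversallyConsistent {X : Type*} [MeasurableSpace X] (Q : PredictiveFunction X) : Prop :=
  ∀ P : Measure (X × ℝ), IsProbabilityMeasure P → IsConsistentFor Q P

/-- `A : (n : ℕ) → (Fin n → X × ℝ) → X × ℝ → ℝ` takes `n` comparison observations and a new one. -/
structure IsConformityMeasure {X : Type*} [MeasurableSpace X]
    (A : (n : ℕ) → (Fin n → X × ℝ) → X × ℝ → ℝ) : Prop where
  measurable : ∀ n, 1 ≤ n → Measurable fun p : (Fin n → X × ℝ) × (X × ℝ) => A n p.1 p.2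
  invariant : ∀ n, 1 ≤ n → ∀ (z : Fin n → X × ℝ) (w : X × ℝ) (π : Equiv.Perm (Fin n)),
    A n (fun i => z (π i)) w = A n z w

/-- `κ n w` is the equivalence relation on the `n + 1` indices assigned to the sequence `w`. -/
structure IsTaxonomy {X : Type*} [MeasurableSpace X]
    (κ : (n : ℕ) → (Fin (n + 1) → X × ℝ) → Setoid (Fin (n + 1))) : Prop where
  measurable : ∀ n, 1 ≤ n → ∀ i j, MeasurableSet {w : Fin (n + 1) → X × ℝ | κ n w i j}
  /-- Equivariance under the permutations `π` that respect the relation assigned to `w`. -/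
  equivariant : ∀ n, 1 ≤ n → ∀ (w : Fin (n + 1) → X × ℝ) (π : Equiv.Perm (Fin (n + 1))),
    (∀ i, κ n w (π i) i) → ∀ i j, κ n w i j → κ n (fun k => w (π k)) (π i) (π j)

/-- The conformity score of the `i`-th element of the sequence `w`, compared with the others. -/
def score {X : Type*} (A : (n : ℕ) → (Fin n → X × ℝ) → X × ℝ → ℝ) (n : ℕ)
    (w : Fin (n + 1) → X × ℝ) (i : Fin (n + 1)) : ℝ :=
  A n (i.removeNth w) (w i)

/-- The equivalence class of the index `j`. -/
def taxonomyClass {X : Type*} (κ : (n : ℕ) → (Fin (n + 1) → X × ℝ) → Setoid (Fin (n + 1)))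
    (n : ℕ) (w : Fin (n + 1) → X × ℝ) (j : Fin (n + 1)) : Set (Fin (n + 1)) :=
  {i | κ n w i j}

/-- The Mondrian transducer. Here `w` is the training sequence extended by the test observation,
which has the index `Fin.last n`. -/
def mondrianTransducer {X : Type*}
    (κ : (n : ℕ) → (Fin (n + 1) → X × ℝ) → Setoid (Fin (n + 1)))
    (A : (n : ℕ) → (Fin n → X × ℝ) → X × ℝ → ℝ) : PredictiveFunction X :=
  fun n z t τ =>
    let w : Fin (n + 1) → X × ℝ := Fin.snoc (α := fun _ => X × ℝ) z t
    let C := taxonomyClass κ n w (Fin.last n)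
    ({i ∈ C | score A n w i < score A n w (Fin.last n)}.ncard : ℝ) / (C.ncard : ℝ) +
      (τ : ℝ) *
        (({i ∈ C | score A n w i = score A n w (Fin.last n)}.ncard : ℝ) / (C.ncard : ℝ))

def IsMondrianTransducer {X : Type*} [MeasurableSpace X] (Q : PredictiveFunction X) : Prop :=
  ∃ κ A, IsTaxonomy κ ∧ IsConformityMeasure A ∧ ∀ n, 1 ≤ n → Q n = mondrianTransducer κ A n

def IsMondrianPredictiveSystem {X : Type*} [MeasurableSpace X] (Q : PredictiveFunction X) : Prop :=
  IsMondrianTransducer Q ∧ IsRandomizedPredictiveSystem Q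

def trivialConformityMeasure (X : Type*) : (n : ℕ) → (Fin n → X × ℝ) → X × ℝ → ℝ :=
  fun _ _ t => t.2

/-- Bin widths `h 1 ≥ h 2 ≥ …`, integer powers of `2`, with `h n → 0` and `n * h n → ∞`. -/
structure IsBinWidthSequence (h : ℕ → ℝ) : Prop where
  isPowerOfTwo : ∀ n, 1 ≤ n → ∃ k : ℤ, h n = (2 : ℝ) ^ k
  antitone : AntitoneOn h (Set.Ici 1)
  tendsto_zero : Tendsto h atTop (𝓝 0)
  tendsto_mul : Tendsto (fun n : ℕ => (n : ℝ) * h n) atTop atTop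

/-- For `h > 0`, the number `k` of the cell `[k * h, (k + 1) * h)` that contains `x`. -/
def cellIndex (h x : ℝ) : ℤ := ⌊x / h⌋

theorem cellIndex_eq_iff {h : ℝ} (hh : 0 < h) (x : ℝ) (k : ℤ) :
    cellIndex h x = k ↔ x ∈ Set.Ico ((k : ℝ) * h) (((k : ℝ) + 1) * h) := by
  rw [cellIndex, Int.floor_eq_iff, le_div_iff₀ hh, div_lt_iff₀ hh, Set.mem_Ico]

/-- Two indices are equivalent if the predictors, mapped to `ℝ` by `φ`, are in the same cell of the
partition into intervals of length `h n`. -/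
def histogramTaxonomy {X : Type*} (φ : X → ℝ) (h : ℕ → ℝ) :
    (n : ℕ) → (Fin (n + 1) → X × ℝ) → Setoid (Fin (n + 1)) :=
  fun n w => Setoid.ker fun i => cellIndex (h n) (φ (w i).1)

def histogramSystem {X : Type*} (φ : X → ℝ) (h : ℕ → ℝ) : PredictiveFunction X :=
  mondrianTransducer (histogramTaxonomy φ h) (trivialConformityMeasure X)

end

end PredictiveSystems

open MeasureTheory Filter Topology

namespace PredictiveSystems

noncomputable section

/-! Uniformity is a finite identity plus exchangeability. For a fixed sequence of `n + 1`
observations, let each index in turn play the test observation: its smoothed rank in its own cell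
spreads the tie classes over adjacent intervals that tile `[0, 1]`, so the probabilities of a rank
at most `α` average to exactly `α` (`sum_volume_smoothedRank_le`). Under a product law all indices
have the same probability, so the last one has it too.

For consistency, `∫ f dQ_n` is the mean of `f` over the training responses in the test cell, up to
the factor `K / (K + 1)`, where `K` is their number. It is compared with the conditional expectation
given the cell, and that with the one given `x`. The first difference is small by Chebyshev's
inequality when the expected cell count `n p` is large (`measure_abs_cellMean_sub_ge_le`), and cells
with small `n p` carry little mass because `n h_n → ∞` (`tendsto_measure_cell_small`). Dyadic widths
make the partitions nested, so the second difference is handled by Lévy's upward martingale theorem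
(`tendsto_measure_condExp_cell_sub`). -/

/-! ### Smoothed ranks and their uniformity. -/

/-- Summing the increments of `g` over the jumps of the counting function of `y` on `s`. -/
theorem sum_count_sub_count {ι : Type*} (g : ℕ → ℝ) (y : ι → ℝ) (V : Finset ℝ) :
    ∀ s : Finset ι, (∀ i ∈ s, y i ∈ V) →
      ∑ v ∈ V, (g (s.filter fun i => y i ≤ v).card - g (s.filter fun i => y i < v).card) =
        g s.card - g 0 := by
  classical
  induction V using Finset.induction_on_max with
  | empty =>
    intro s hs
    have : s = ∅ := Finset.eq_empty_of_forall_notMem fun i hi => by simpa using hs i hi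
    simp [this]
  | insert a V ha ih =>
    intro s hs
    have haV : a ∉ V := fun h => lt_irrefl _ (ha a h)
    have hle : ∀ i ∈ s, y i ≤ a := fun i hi => by
      rcases Finset.mem_insert.1 (hs i hi) with h | h
      exacts [h.le, (ha _ h).le]
    rw [Finset.sum_insert haV, Finset.filter_true_of_mem hle]
    -- The largest value `a` contributes the last increment; what lies strictly below it telescopes
    -- by induction, with unchanged counts at every `v < a`.
    have ih' := ih (s.filter fun i => y i < a) fun i hi => by
      rw [Finset.mem_filter] at hi
      exact (Finset.mem_insert.1 (hs i hi.1)).resolve_left hi.2.ne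
    have hsum : ∑ v ∈ V, (g (s.filter fun i => y i ≤ v).card -
        g (s.filter fun i => y i < v).card) = g (s.filter fun i => y i < a).card - g 0 := by
      rw [← ih']
      refine Finset.sum_congr rfl fun v hv => ?_
      rw [Finset.filter_filter, Finset.filter_filter]
      congr 3
      · exact Finset.filter_congr fun i _ => ⟨fun h => ⟨h.trans_lt (ha v hv), h⟩, fun h => h.2⟩
      · exact Finset.filter_congr fun i _ => ⟨fun h => ⟨h.trans (ha v hv), h⟩, fun h => h.2⟩
    rw [hsum]
    ring

/-- The smoothed rank of `y j` among the `y i` with `c i = c j`, normalized to `[0, 1]`. -/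
def smoothedRank {ι : Type*} [Fintype ι] (c : ι → ℤ) (y : ι → ℝ) (j : ι) (τ : ℝ) : ℝ :=
  ((Finset.univ.filter fun i => c i = c j ∧ y i < y j).card +
    τ * (Finset.univ.filter fun i => c i = c j ∧ y i = y j).card) /
      (Finset.univ.filter fun i => c i = c j).card

theorem histogramSystem_eq_smoothedRank {X : Type*} (φ : X → ℝ) (h : ℕ → ℝ) (n : ℕ)
    (z : Fin n → X × ℝ) (t : X × ℝ) (τ : unitInterval) :
    histogramSystem φ h n z t τ =
      smoothedRank
        (fun i => cellIndex (h n) (φ (Fin.snoc (α := fun _ => X × ℝ) z t i).1))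
        (fun i => (Fin.snoc (α := fun _ => X × ℝ) z t i).2) (Fin.last n) τ := by
  have hn : ∀ (p : Fin (n + 1) → Prop) [DecidablePred p],
      {i | p i}.ncard = (Finset.univ.filter p).card := fun p _ => by
    rw [← Set.ncard_coe_finset]
    congr 1
    ext i
    simp
  rw [smoothedRank, ← hn, ← hn, ← hn, add_div, mul_div_assoc]
  rfl

/-- The test observation always lies in its own cell and ties with itself: this is the `τ` in the
numerator and the `1` in the denominator. -/
theorem histogramSystem_eq {X : Type*} (φ : X → ℝ) (h : ℕ → ℝ) (n : ℕ)
    (z : Fin n → X × ℝ) (t : X × ℝ) (τ : unitInterval) :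
    histogramSystem φ h n z t τ =
      (∑ i, (if cellIndex (h n) (φ (z i).1) = cellIndex (h n) (φ t.1) then
          ((if (z i).2 < t.2 then 1 else 0) + (τ : ℝ) * (if (z i).2 = t.2 then 1 else 0))
          else 0) + τ) /
        (∑ i, (if cellIndex (h n) (φ (z i).1) = cellIndex (h n) (φ t.1) then 1 else 0) + 1) := by
  rw [histogramSystem_eq_smoothedRank, smoothedRank]
  simp only [Finset.card_filter, Nat.cast_add, Nat.cast_sum, Fin.sum_univ_castSucc, Fin.snoc_castSucc,
    Fin.snoc_last, lt_irrefl, and_false, if_false, if_true, and_self, Nat.cast_ite, Nat.cast_one,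
    Nat.cast_zero, add_zero]
  congr 1
  rw [mul_add, mul_one, ← add_assoc, Finset.mul_sum, ← Finset.sum_add_distrib]
  congr 1
  refine Finset.sum_congr rfl fun i _ => ?_
  split_ifs <;> simp_all

/-- The length is written as an increment of `min t` so that it telescopes over successive tie
classes. -/
theorem volume_setOf_add_mul_le {L E t : ℝ} (hE : 0 < E) :
    volume {τ : unitInterval | L + τ * E ≤ t} =
      ENNReal.ofReal ((min t (L + E) - min t L) / E) := by
  rcases lt_or_ge t L with h1 | h1
  · rw [min_eq_left h1.le, min_eq_left (by linarith), sub_self, zero_div, ENNReal.ofReal_zero]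
    convert measure_empty (μ := (volume : Measure unitInterval))
    ext τ
    simp only [Set.mem_ofPred_eq, Set.mem_empty_iff_false, iff_false, not_le]
    have := mul_nonneg τ.2.1 hE.le
    linarith
  · rw [min_eq_right h1]
    have hc0 : 0 ≤ (min t (L + E) - L) / E :=
      div_nonneg (sub_nonneg.2 (le_min h1 (by linarith))) hE.le
    have hc1 : (min t (L + E) - L) / E ≤ 1 := by
      rw [div_le_one hE]
      linarith [min_le_right t (L + E)]
    rw [← unitInterval.volume_Iic ⟨_, hc0, hc1⟩]
    congr 1
    ext τ
    rw [Set.mem_ofPred_eq, Set.mem_Iic, ← Subtype.coe_le_coe, Subtype.coe_mk, le_div_iff₀ hE,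
      le_sub_iff_add_le, le_min_iff]
    have := mul_le_mul_of_nonneg_right τ.2.2 hE.le
    constructor
    · intro h
      constructor <;> linarith
    · intro h
      linarith [h.1]

theorem volume_smoothedRank_le {ι : Type*} [Fintype ι] (c : ι → ℤ) (y : ι → ℝ) (j : ι) (α : ℝ) :
    volume {τ : unitInterval | smoothedRank c y j τ ≤ α} =
      ENNReal.ofReal
        ((min (α * (Finset.univ.filter fun i => c i = c j).card)
              ((Finset.univ.filter fun i => c i = c j).filter fun i => y i ≤ y j).card -
            min (α * (Finset.univ.filter fun i => c i = c j).card)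
              ((Finset.univ.filter fun i => c i = c j).filter fun i => y i < y j).card) /
          ((Finset.univ.filter fun i => c i = c j).filter fun i => y i = y j).card) := by
  classical
  have hN : (0 : ℝ) < (Finset.univ.filter fun i => c i = c j).card :=
    Nat.cast_pos.2 (Finset.card_pos.2 ⟨j, by simp⟩)
  have hE : (0 : ℝ) < ((Finset.univ.filter fun i => c i = c j).filter fun i => y i = y j).card :=
    Nat.cast_pos.2 (Finset.card_pos.2 ⟨j, by simp⟩)
  have hsum : (((Finset.univ.filter fun i => c i = c j).filter fun i => y i ≤ y j).card : ℝ) =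
      ((Finset.univ.filter fun i => c i = c j).filter fun i => y i < y j).card +
        ((Finset.univ.filter fun i => c i = c j).filter fun i => y i = y j).card := by
    rw [← Nat.cast_add, ← Finset.card_union_of_disjoint]
    · rw [← Finset.filter_or]
      simp only [le_iff_lt_or_eq]
    · exact Finset.disjoint_filter.2 fun i _ h => h.ne
  rw [hsum, ← volume_setOf_add_mul_le hE]
  congr 1
  ext τ
  simp only [Set.mem_ofPred_eq, smoothedRank, div_le_iff₀ hN, Finset.filter_filter]

/-- The average over all indices of the probability that the smoothed rank is at most `α`
equals `α`. -/
theorem sum_volume_smoothedRank_le {ι : Type*} [Fintype ι] (c : ι → ℤ) (y : ι → ℝ) {α : ℝ}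
    (hα : α ∈ Set.Icc (0 : ℝ) 1) :
    ∑ j, volume {τ : unitInterval | smoothedRank c y j τ ≤ α} =
      Fintype.card ι * ENNReal.ofReal α := by
  classical
  have hnonneg : ∀ (t a b E : ℝ), a ≤ b → 0 ≤ E → 0 ≤ (min t b - min t a) / E :=
    fun t a b E hab hE => div_nonneg (sub_nonneg.2 (min_le_min_left _ hab)) hE
  simp only [volume_smoothedRank_le c y _ α]
  rw [← ENNReal.ofReal_sum_of_nonneg]
  swap
  · intro j _
    refine hnonneg _ _ _ _ (Nat.cast_le.2 (Finset.card_le_card ?_)) (Nat.cast_nonneg _)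
    exact Finset.monotone_filter_right _ fun i _ h => le_of_lt h
  rw [← ENNReal.ofReal_natCast, ← ENNReal.ofReal_mul (Nat.cast_nonneg _)]
  congr 1
  rw [← Finset.card_univ, Finset.card_eq_sum_card_image c, Nat.cast_sum, Finset.sum_mul,
    ← Finset.sum_fiberwise_of_maps_to (g := c) (t := Finset.univ.image c) (by simp)]
  refine Finset.sum_congr rfl fun k _ => ?_
  set s := Finset.univ.filter fun i => c i = k with hs
  -- Since `α * s.card` lies between `0` and `s.card`, the truncated count increases by exactly `α *
  -- s.card` over the whole cell.
  have key := sum_count_sub_count (fun m => min (α * s.card) (m : ℝ)) y (s.image y) s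
    (fun i hi => Finset.mem_image_of_mem y hi)
  have hcard : α * s.card ≤ s.card := mul_le_of_le_one_left (Nat.cast_nonneg _) hα.2
  have hcard0 : 0 ≤ α * s.card := mul_nonneg hα.1 (Nat.cast_nonneg _)
  simp only [min_eq_left hcard, Nat.cast_zero, min_eq_right hcard0, sub_zero] at key
  rw [mul_comm (s.card : ℝ), ← key,
    ← Finset.sum_fiberwise_of_maps_to (g := y) (t := s.image y)
      (fun i hi => Finset.mem_image_of_mem y hi)]
  refine Finset.sum_congr rfl fun v hv => ?_
  obtain ⟨i₀, hi₀, rfl⟩ := Finset.mem_image.1 hv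
  have hpos : ((s.filter fun i => y i = y i₀).card : ℝ) ≠ 0 :=
    Nat.cast_ne_zero.2 (Finset.card_pos.2 ⟨i₀, by simp [hi₀]⟩).ne'
  -- All members of a tie class give the same quotient, so summing over the class cancels its size
  -- in the denominator.
  rw [Finset.sum_congr rfl (g := fun _ =>
    (min (α * s.card) (s.filter fun i => y i ≤ y i₀).card -
      min (α * s.card) (s.filter fun i => y i < y i₀).card) /
        ((s.filter fun i => y i = y i₀).card : ℝ))]
  · rw [Finset.sum_const, nsmul_eq_mul, mul_div_cancel₀ _ hpos]
  · intro j hj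
    rw [Finset.mem_filter, hs, Finset.mem_filter] at hj
    rw [hj.1.2, hj.2]

theorem smoothedRank_comp_equiv {ι : Type*} [Fintype ι] (c : ι → ℤ) (y : ι → ℝ)
    (π : Equiv.Perm ι) (j : ι) (τ : ℝ) :
    smoothedRank (fun i => c (π i)) (fun i => y (π i)) j τ = smoothedRank c y (π j) τ := by
  classical
  have h : ∀ (p : ι → Prop) [DecidablePred p],
      (Finset.univ.filter fun i => p (π i)).card = (Finset.univ.filter p).card := fun p _ => by
    rw [← Finset.card_map π.toEmbedding]
    congr 1
    ext i
    simp only [Finset.mem_map_equiv, Finset.mem_filter, Finset.mem_univ, true_and,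
      Equiv.apply_symm_apply]
  simp only [smoothedRank]
  rw [h (fun i => c i = c (π j) ∧ y i < y (π j)), h (fun i => c i = c (π j) ∧ y i = y (π j)),
    h (fun i => c i = c (π j))]

theorem measurable_smoothedRank {ι Ω : Type*} [Fintype ι] [MeasurableSpace Ω] {c : Ω → ι → ℤ}
    {y : Ω → ι → ℝ} {τ : Ω → ℝ} (hc : ∀ i, Measurable fun ω => c ω i)
    (hy : ∀ i, Measurable fun ω => y ω i) (hτ : Measurable τ) (j : ι) :
    Measurable fun ω => smoothedRank (c ω) (y ω) j (τ ω) := by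
  classical
  have hc' : ∀ i, MeasurableSet {ω | c ω i = c ω j} :=
    fun i => measurableSet_eq_fun (hc i) (hc j)
  simp only [smoothedRank, Finset.card_filter, Nat.cast_sum, Nat.cast_ite, Nat.cast_one,
    Nat.cast_zero]
  refine Measurable.div (Measurable.add ?_ (hτ.mul ?_)) ?_ <;>
    refine Finset.measurable_sum _ fun i _ => Measurable.ite ?_ measurable_const measurable_const
  · exact (hc' i).inter (measurableSet_lt (hy i) (hy j))
  · exact (hc' i).inter (measurableSet_eq_fun (hy i) (hy j))
  · exact hc' i

theorem measurable_cellIndex (h : ℝ) : Measurable (cellIndex h) :=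
  Int.measurable_floor.comp (measurable_id.div_const h)

theorem lintegral_pi_comp_perm {Z : Type*} [MeasurableSpace Z] (P : Measure Z)
    [IsProbabilityMeasure P] {ι : Type*} [Fintype ι] (π : Equiv.Perm ι)
    (F : (ι → Z) → ENNReal) :
    ∫⁻ w, F (fun i => w (π i)) ∂(Measure.pi fun _ : ι => P) =
      ∫⁻ w, F w ∂(Measure.pi fun _ : ι => P) := by
  have := (measurePreserving_piCongrLeft (fun _ : ι => P) π.symm).lintegral_map_equiv F
  rw [this]
  refine lintegral_congr fun w => congrArg F ?_
  ext1 i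
  have := Equiv.piCongrLeft_apply_apply (fun _ : ι => Z) π.symm w (π i)
  simpa using! this.symm

theorem uniform_histogramSystem {X : Type*} [MeasurableSpace X] {φ : X → ℝ} (h : ℕ → ℝ)
    (hφ : Measurable φ) (n : ℕ) (P : Measure (X × ℝ)) [IsProbabilityMeasure P] {α : ℝ}
    (hα : α ∈ Set.Icc (0 : ℝ) 1) :
    jointLaw P n {p | histogramSystem φ h n p.1 p.2.1 p.2.2 ≤ α} = ENNReal.ofReal α := by
  set R : (Fin (n + 1) → X × ℝ) → Fin (n + 1) → ℝ → ℝ := fun w j τ =>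
    smoothedRank (fun i => cellIndex (h n) (φ (w i).1)) (fun i => (w i).2) j τ with hR
  have hRm : ∀ j, Measurable fun p : (Fin (n + 1) → X × ℝ) × unitInterval => R p.1 j p.2 :=
    fun j => measurable_smoothedRank
      (fun i => (measurable_cellIndex _).comp (hφ.comp (by fun_prop)))
      (fun i => by fun_prop) (by fun_prop) j
  have hms : ∀ j, MeasurableSet {p : (Fin (n + 1) → X × ℝ) × unitInterval | R p.1 j p.2 ≤ α} :=
    fun j => measurableSet_le (hRm j) measurable_const
  set G : Fin (n + 1) → (Fin (n + 1) → X × ℝ) → ENNReal := fun j w =>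
    volume {τ : unitInterval | R w j τ ≤ α} with hG
  have hGm : ∀ j, Measurable (G j) := fun j => measurable_measure_prodMk_left (hms j)
  have hsym : ∀ j, ∫⁻ w, G j w ∂(Measure.pi fun _ => P) =
      ∫⁻ w, G (Fin.last n) w ∂(Measure.pi fun _ => P) := fun j => by
    -- Exchangeability: swapping `j` with the last index preserves the product law and carries one
    -- rank to the other.
    rw [← lintegral_pi_comp_perm P (Equiv.swap (Fin.last n) j) (G (Fin.last n))]
    refine lintegral_congr fun w => ?_
    simp only [hG, hR]
    have := smoothedRank_comp_equiv (fun i => cellIndex (h n) (φ (w i).1)) (fun i => (w i).2)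
      (Equiv.swap (Fin.last n) j) (Fin.last n)
    simp only [this, Equiv.swap_apply_left]
  have havg : ∫⁻ w, G (Fin.last n) w ∂(Measure.pi fun _ => P) = ENNReal.ofReal α := by
    have h1 : ((n + 1 : ℕ) : ENNReal) * ∫⁻ w, G (Fin.last n) w ∂(Measure.pi fun _ => P) =
        ((n + 1 : ℕ) : ENNReal) * ENNReal.ofReal α := by
      calc _ = ∑ j, ∫⁻ w, G j w ∂(Measure.pi fun _ => P) := by
            simp only [hsym, Finset.sum_const, Finset.card_univ, Fintype.card_fin, nsmul_eq_mul]
        _ = ∫⁻ w, ∑ j, G j w ∂(Measure.pi fun _ => P) :=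
            (lintegral_finsetSum _ fun j _ => hGm j).symm
        _ = ∫⁻ _, ((n + 1 : ℕ) : ENNReal) * ENNReal.ofReal α ∂(Measure.pi fun _ => P) := by
            refine lintegral_congr fun w => ?_
            have := sum_volume_smoothedRank_le (fun i => cellIndex (h n) (φ (w i).1))
              (fun i => (w i).2) hα
            rwa [Fintype.card_fin] at this
        _ = _ := by simp
    exact (ENNReal.mul_right_inj (by simp) (ENNReal.natCast_ne_top _)).1 h1
  rw [← havg]
  refine Eq.trans ?_ (Measure.prod_apply (hms (Fin.last n)))
  have hmp : MeasurePreserving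
      (fun p : (Fin n → X × ℝ) × (X × ℝ) × unitInterval =>
        ((MeasurableEquiv.piFinSuccAbove (fun _ => X × ℝ) (Fin.last n)).symm (p.2.1, p.1), p.2.2))
      (jointLaw P n) ((Measure.pi fun _ : Fin (n + 1) => P).prod volume) := by
    have h1 := (measurePreserving_piFinSuccAbove (fun _ : Fin (n + 1) => P) (Fin.last n)).symm
    have h2 := h1.comp (Measure.measurePreserving_swap (μ := Measure.pi fun _ : Fin n => P) (ν := P))
    have h3 := h2.prod (MeasurePreserving.id (volume : Measure unitInterval))
    exact h3.comp ((measurePreserving_prodAssoc (Measure.pi fun _ : Fin n => P) P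
      (volume : Measure unitInterval)).symm)
  rw [← hmp.measure_preimage (hms _).nullMeasurableSet]
  congr 1
  ext p
  simp only [Set.mem_ofPred_eq, Set.mem_preimage, histogramSystem_eq_smoothedRank, hR]
  have : (MeasurableEquiv.piFinSuccAbove (fun _ => X × ℝ) (Fin.last n)).symm (p.2.1, p.1) =
      Fin.snoc (α := fun _ => X × ℝ) p.1 p.2.1 := by
    rw [← Fin.insertNth_last']
    rfl
  rw [this]

/-! ### The remaining axioms of a Mondrian predictive system. -/

/-- As `y` crosses a training response of the cell, that term passes through `0`, `τ`, `1`; the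
denominator does not depend on `y`. -/
theorem monotone_histogramSystem {X : Type*} {φ : X → ℝ} (h : ℕ → ℝ)
    (n : ℕ) (z : Fin n → X × ℝ) (x : X) (τ : unitInterval) :
    Monotone fun y : ℝ => histogramSystem φ h n z (x, y) τ := by
  intro y y' hy
  simp only [histogramSystem_eq]
  gcongr with i
  by_cases hc : cellIndex (h n) (φ (z i).1) = cellIndex (h n) (φ x)
  · simp only [hc, if_true]
    have h0 := τ.2.1
    have h1 := τ.2.2
    by_cases h2 : (z i).2 < y
    · simp [h2, h2.ne, h2.trans_le hy, (h2.trans_le hy).ne]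
    · by_cases h3 : (z i).2 < y'
      · simp only [h2, h3, h3.ne, if_true, if_false]
        split_ifs <;> linarith
      · have h4 : (z i).2 = y → (z i).2 = y' := fun h => le_antisymm (h.trans_le hy) (not_lt.1 h3)
        simp only [h2, h3, if_false]
        split_ifs with h5 h6 <;> first | linarith | exact absurd (h4 h5) h6
  · simp [hc]

theorem histogramSystem_mem_Icc {X : Type*} {φ : X → ℝ} (h : ℕ → ℝ)
    (n : ℕ) (z : Fin n → X × ℝ) (w : X × ℝ) (τ : unitInterval) :
    histogramSystem φ h n z w τ ∈ Set.Icc (0 : ℝ) 1 := by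
  have h0 := τ.2.1
  have h1 := τ.2.2
  rw [histogramSystem_eq]
  refine ⟨?_, div_le_one_of_le₀ ?_ ?_⟩
  · refine div_nonneg (add_nonneg (Finset.sum_nonneg fun i _ => ?_) h0)
      (add_nonneg (Finset.sum_nonneg fun i _ => ?_) zero_le_one)
    · split_ifs <;> linarith
    · split_ifs <;> linarith
  · gcongr with i
    split_ifs <;> linarith
  · exact add_nonneg (Finset.sum_nonneg fun i _ => by split_ifs <;> linarith) zero_le_one

theorem isRandomizedPredictiveSystem_histogramSystem {X : Type*} [MeasurableSpace X] {φ : X → ℝ} (h : ℕ → ℝ)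
    (hφ : Measurable φ) :
    IsRandomizedPredictiveSystem (histogramSystem φ h) where
  measurable n _ := by
    have hm : Measurable fun p : (Fin n → X × ℝ) × (X × ℝ) × unitInterval =>
        Fin.snoc (α := fun _ => X × ℝ) p.1 p.2.1 := by
      rw [measurable_pi_iff]
      intro i
      refine Fin.lastCases ?_ (fun i => ?_) i
      · simp only [Fin.snoc_last]
        fun_prop
      · simp only [Fin.snoc_castSucc]
        fun_prop
    simp only [histogramSystem_eq_smoothedRank]
    refine measurable_smoothedRank (fun i => (measurable_cellIndex _).comp (hφ.comp ?_))
      (fun i => ?_) (by fun_prop) _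
    · exact measurable_fst.comp ((measurable_pi_apply i).comp hm)
    · exact measurable_snd.comp ((measurable_pi_apply i).comp hm)
  mem_Icc n _ := histogramSystem_mem_Icc h n
  monotone_response n _ := monotone_histogramSystem h n
  monotone_tau n _ z x y τ τ' hτ := by
    have : (τ : ℝ) ≤ τ' := hτ
    simp only [histogramSystem_eq]
    gcongr with i
    split_ifs <;> linarith
  tendsto_atBot n _ z x := by
    refine tendsto_const_nhds.congr' ?_
    filter_upwards [eventually_all.2 fun i => eventually_lt_atBot (z i).2] with y hy
    simp only [histogramSystem_eq, (hy _).not_gt, (hy _).ne', Set.Icc.coe_zero]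
    simp
  tendsto_atTop n _ z x := by
    refine tendsto_const_nhds.congr' ?_
    filter_upwards [eventually_all.2 fun i => eventually_gt_atTop (z i).2] with y hy
    simp only [histogramSystem_eq, hy, (hy _).ne, if_true, if_false, Set.Icc.coe_one, mul_zero,
      add_zero]
    refine (div_self ?_).symm
    exact (add_pos_of_nonneg_of_pos (Finset.sum_nonneg fun i _ => by split_ifs <;> norm_num)
      one_pos).ne'
  uniform n _ P _ _ hα := uniform_histogramSystem h hφ n P hα

theorem isTaxonomy_histogramTaxonomy {X : Type*} [MeasurableSpace X] {φ : X → ℝ} (h : ℕ → ℝ)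
    (hφ : Measurable φ) : IsTaxonomy (histogramTaxonomy φ h) where
  measurable n _ i j := by
    refine measurableSet_eq_fun ?_ ?_ <;>
    exact (measurable_cellIndex _).comp (hφ.comp (by fun_prop))
  equivariant n _ w π hπ i j hij :=
    -- In the permuted sequence the entries compared are `w (π (π i))` and `w (π (π j))`, hence two
    -- uses of `hπ` on each side.
    (hπ (π i)).trans ((hπ i).trans (hij.trans ((hπ j).symm.trans (hπ (π j)).symm)))

theorem isConformityMeasure_trivialConformityMeasure {X : Type*} [MeasurableSpace X]
    :
    IsConformityMeasure (trivialConformityMeasure X) where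
  measurable n _ := by
    unfold trivialConformityMeasure
    fun_prop
  invariant _ _ _ _ _ := rfl

theorem isMondrianPredictiveSystem_histogramSystem {X : Type*} [MeasurableSpace X] {φ : X → ℝ} (h : ℕ → ℝ)
    (hφ : Measurable φ) :
    IsMondrianPredictiveSystem (histogramSystem φ h) :=
  ⟨⟨histogramTaxonomy φ h, trivialConformityMeasure X, isTaxonomy_histogramTaxonomy h hφ,
    isConformityMeasure_trivialConformityMeasure, fun _ _ => rfl⟩,
    isRandomizedPredictiveSystem_histogramSystem h hφ⟩

/-! ### The predictive distribution as an empirical measure. -/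

/-- The training observations in the histogram cell of `x`. -/
def trainingCell {X : Type*} (φ : X → ℝ) (h : ℕ → ℝ) (n : ℕ) (z : Fin n → X × ℝ) (x : X) :
    Finset (Fin n) :=
  Finset.univ.filter fun i => cellIndex (h n) (φ (z i).1) = cellIndex (h n) (φ x)

theorem rightLim_histogramSystem {X : Type*} (φ : X → ℝ) (h : ℕ → ℝ) (n : ℕ)
    (z : Fin n → X × ℝ) (x : X) (τ : unitInterval) (v : ℝ) :
    Function.rightLim (fun y => histogramSystem φ h n z (x, y) τ) v =
      (∑ i ∈ trainingCell φ h n z x, (if (z i).2 ≤ v then 1 else 0) + τ) /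
        ((trainingCell φ h n z x).card + 1) := by
  refine rightLim_eq_of_tendsto (tendsto_const_nhds.congr' ?_)
  -- Immediately to the right of `v` there are no ties, so `τ` survives only through the test
  -- observation itself.
  have hev : ∀ i, ∀ᶠ y in 𝓝[>] v, (z i).2 ≤ v ∨ y < (z i).2 := fun i => by
    rcases le_or_gt (z i).2 v with hi | hi
    · exact Eventually.of_forall fun _ => Or.inl hi
    · exact (eventually_nhdsWithin_of_eventually_nhds (eventually_lt_nhds hi)).mono
        fun _ => Or.inr
  filter_upwards [eventually_all.2 hev, self_mem_nhdsWithin] with y hy hvy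
  rw [histogramSystem_eq, trainingCell, Finset.sum_filter, Finset.card_filter, Nat.cast_sum]
  simp only [Nat.cast_ite, Nat.cast_one, Nat.cast_zero]
  congr 2
  refine Finset.sum_congr rfl fun i _ => ?_
  rcases hy i with hi | hi
  · have := lt_of_le_of_lt hi hvy
    simp [hi, this, this.ne]
  · have := lt_trans hvy hi
    simp [this.not_ge, hi.not_gt, hi.ne']

/-- The term `τ` is constant in `v` and cancels in increments. The total mass is `K / (K + 1)` for
`K` training points in the cell; the rest sits at infinity. -/
theorem predictiveMeasure_histogramSystem {X : Type*} (φ : X → ℝ) (h : ℕ → ℝ) (n : ℕ)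
    (z : Fin n → X × ℝ) (x : X) (τ : unitInterval) :
    predictiveMeasure (fun y => histogramSystem φ h n z (x, y) τ) =
      ENNReal.ofReal ((trainingCell φ h n z x).card + 1 : ℝ)⁻¹ •
        ∑ i ∈ trainingCell φ h n z x, Measure.dirac (z i).2 := by
  have hmono := monotone_histogramSystem (φ := φ) h n z x τ
  have : IsLocallyFiniteMeasure
      (predictiveMeasure (fun y => histogramSystem φ h n z (x, y) τ)) := by
    rw [predictiveMeasure, dif_pos hmono]
    infer_instance
  refine Measure.ext_of_Ioc _ _ fun u v huv => ?_
  rw [predictiveMeasure_Ioc hmono, rightLim_histogramSystem, rightLim_histogramSystem, ← sub_div,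
    add_sub_add_right_eq_sub, ← Finset.sum_sub_distrib, div_eq_inv_mul,
    ENNReal.ofReal_mul (by positivity), ENNReal.ofReal_sum_of_nonneg, Measure.smul_apply,
    Measure.finsetSum_apply, smul_eq_mul]
  · congr 1
    refine Finset.sum_congr rfl fun i _ => ?_
    rw [Measure.dirac_apply' _ measurableSet_Ioc]
    by_cases h1 : (z i).2 ≤ u
    · simp [h1, h1.trans huv.le, h1.not_gt]
    · by_cases h2 : (z i).2 ≤ v
      · simp [h1, h2, not_le.1 h1]
      · simp [h1, h2]
  · intro i _
    by_cases h1 : (z i).2 ≤ u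
    · simp [h1, h1.trans huv.le]
    · simp only [h1, if_false]
      split_ifs <;> norm_num

theorem integral_predictiveMeasure_histogramSystem {X : Type*} (φ : X → ℝ) (h : ℕ → ℝ) (n : ℕ)
    (z : Fin n → X × ℝ) (x : X) (τ : unitInterval) (f : ℝ → ℝ) :
    ∫ y, f y ∂(predictiveMeasure fun y => histogramSystem φ h n z (x, y) τ) =
      (∑ i ∈ trainingCell φ h n z x, f (z i).2) / ((trainingCell φ h n z x).card + 1) := by
  rw [predictiveMeasure_histogramSystem, integral_smul_measure,
    integral_finsetSum_measure fun i _ => integrable_dirac (by simp),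
    ENNReal.toReal_ofReal (by positivity), smul_eq_mul, div_eq_inv_mul]
  simp only [integral_dirac]

/-! ### Concentration of cell averages. -/

theorem measure_abs_sum_sub_ge_le {Z : Type*} [MeasurableSpace Z] (P : Measure Z)
    [IsProbabilityMeasure P] (n : ℕ) {g : Z → ℝ} (hg : MemLp g 2 P) {v c : ℝ}
    (hv : ∫ w, g w ^ 2 ∂P ≤ v) (hc : 0 < c) :
    (Measure.pi fun _ : Fin n => P) {z | c ≤ |∑ i, g (z i) - n * ∫ w, g w ∂P|} ≤
      ENNReal.ofReal (n * v / c ^ 2) := by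
  set μ := Measure.pi fun _ : Fin n => P
  have hgi : ∀ i : Fin n, MemLp (fun z : Fin n → Z => g (z i)) 2 μ := fun i =>
    hg.comp_measurePreserving (measurePreserving_eval (fun _ : Fin n => P) i)
  have hmem : MemLp (fun z : Fin n → Z => ∑ i, g (z i)) 2 μ := memLp_finsetSum _ fun i _ => hgi i
  have hint : ∫ z, ∑ i, g (z i) ∂μ = n * ∫ w, g w ∂P := by
    rw [integral_finsetSum _ fun i _ => (hgi i).integrable one_le_two]
    have : ∀ i : Fin n, ∫ z, g (z i) ∂μ = ∫ w, g w ∂P := fun i =>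
      integral_comp_eval (μ := fun _ : Fin n => P) (i := i) hg.1
    simp [this]
  have hvar : ProbabilityTheory.variance (fun z : Fin n → Z => ∑ i, g (z i)) μ ≤ n * v := by
    have h1 := ProbabilityTheory.variance_sum_pi (μ := fun _ : Fin n => P) (X := fun _ => g)
      fun _ => hg
    have h2 : (∑ i : Fin n, fun ω : Fin n → Z => g (ω i)) = fun z => ∑ i, g (z i) := by
      ext z
      simp
    rw [h2] at h1
    rw [h1, Finset.sum_const, Finset.card_univ, Fintype.card_fin, nsmul_eq_mul]
    gcongr
    exact (ProbabilityTheory.variance_le_expectation_sq hg.1).trans hv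
  have := ProbabilityTheory.meas_ge_le_variance_div_sq hmem hc
  rw [hint] at this
  refine this.trans (ENNReal.ofReal_le_ofReal ?_)
  gcongr

/-- The average of `F` over the observations in the cell `k` of the partition given by `c`,
shrunk by one extra observation. -/
def cellMean {Z : Type*} (c : Z → ℤ) (F : Z → ℝ) (n : ℕ) (z : Fin n → Z) (k : ℤ) : ℝ :=
  (∑ i, if c (z i) = k then F (z i) else 0) / ((∑ i, if c (z i) = k then (1 : ℝ) else 0) + 1)

theorem abs_cellMean_le {Z : Type*} (c : Z → ℤ) {F : Z → ℝ} {C : ℝ} (hC : ∀ w, |F w| ≤ C)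
    (hC0 : 0 ≤ C) (n : ℕ) (z : Fin n → Z) (k : ℤ) : |cellMean c F n z k| ≤ C := by
  have hK : (0 : ℝ) ≤ ∑ i, if c (z i) = k then (1 : ℝ) else 0 :=
    Finset.sum_nonneg fun i _ => by split_ifs <;> norm_num
  rw [cellMean, abs_div, abs_of_pos (a := _ + (1 : ℝ)) (by linarith), div_le_iff₀ (by linarith)]
  have : |∑ i, if c (z i) = k then F (z i) else 0| ≤
      C * ∑ i, if c (z i) = k then (1 : ℝ) else 0 := by
    rw [Finset.mul_sum]
    refine (Finset.abs_sum_le_sum_abs _ _).trans (Finset.sum_le_sum fun i _ => ?_)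
    split_ifs
    · simpa using hC (z i)
    · simp
  linarith

theorem measurable_cellMean {Z : Type*} [MeasurableSpace Z] {c : Z → ℤ} (hc : Measurable c)
    {F : Z → ℝ} (hF : Measurable F) (n : ℕ) (k : ℤ) :
    Measurable fun z : Fin n → Z => cellMean c F n z k := by
  have hs : ∀ i : Fin n, MeasurableSet {z : Fin n → Z | c (z i) = k} := fun i =>
    measurableSet_eq_fun (hc.comp (measurable_pi_apply i)) measurable_const
  refine Measurable.div (Finset.measurable_sum _ fun i _ => ?_)
    ((Finset.measurable_sum _ fun i _ => ?_).add_const _)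
  · exact Measurable.ite (hs i) (hF.comp (measurable_pi_apply i)) measurable_const
  · exact Measurable.ite (hs i) measurable_const measurable_const

/-- The cell mean is a ratio of two sums of i.i.d. terms, and Chebyshev's inequality controls each
to within `η n p`. The hypothesis `hn` lets the extra `1` in the denominator be absorbed as another
`η n p`. -/
theorem measure_abs_cellMean_sub_ge_le {Z : Type*} [MeasurableSpace Z] (P : Measure Z)
    [IsProbabilityMeasure P] {c : Z → ℤ} (hc : Measurable c) {F : Z → ℝ} (hF : Measurable F)
    {C : ℝ} (hC : ∀ w, |F w| ≤ C) (hC0 : 0 ≤ C) {n : ℕ} {k : ℤ} {m η : ℝ} (hη : 0 < η)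
    (hm : m * P.real {w | c w = k} = ∫ w in {w | c w = k}, F w ∂P)
    (hn : 1 ≤ η * (n * P.real {w | c w = k})) :
    (Measure.pi fun _ : Fin n => P) {z | η * (1 + 2 * C) ≤ |cellMean c F n z k - m|} ≤
      ENNReal.ofReal ((C ^ 2 + 1) / (η ^ 2 * (n * P.real {w | c w = k}))) := by
  set B := {w | c w = k} with hB
  set p := P.real B with hp
  have hBm : MeasurableSet B := measurableSet_eq_fun hc measurable_const
  have hnp : 0 < n * p := pos_of_mul_pos_right (one_pos.trans_le hn) hη.le
  have hp0 : 0 < p := pos_of_mul_pos_right hnp (Nat.cast_nonneg n)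
  have hn0 : (0 : ℝ) < n := pos_of_mul_pos_left hnp hp0.le
  have hcheb : ∀ (g : Z → ℝ), Measurable g → ∀ D : ℝ, (∀ w, |g w| ≤ D) →
      (Measure.pi fun _ : Fin n => P)
        {z | η * (n * p) ≤ |∑ i, B.indicator g (z i) - n * ∫ w in B, g w ∂P|} ≤
        ENNReal.ofReal (D ^ 2 / (η ^ 2 * (n * p))) := by
    intro g hg D hD
    have hgm : MemLp (B.indicator g) 2 P :=
      MemLp.indicator hBm (MemLp.of_bound hg.aestronglyMeasurable D (ae_of_all _ hD))
    -- The factor `p` matters: it leaves a bound of order `1 / (n p)` that is uniform over cells.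
    have hv : ∫ w, B.indicator g w ^ 2 ∂P ≤ D ^ 2 * p := by
      calc ∫ w, B.indicator g w ^ 2 ∂P ≤ ∫ w, B.indicator (fun _ => D ^ 2) w ∂P := by
            refine integral_mono hgm.integrable_sq
              ((integrable_const _).indicator hBm) fun w => ?_
            by_cases hw : w ∈ B
            · simpa [hw] using sq_le_sq' (abs_le.1 (hD w)).1 (abs_le.1 (hD w)).2
            · simp [hw]
        _ = D ^ 2 * p := by
            rw [integral_indicator_const _ hBm, smul_eq_mul, mul_comm]
    have := measure_abs_sum_sub_ge_le P n hgm hv (mul_pos hη hnp)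
    rw [integral_indicator hBm] at this
    refine this.trans (ENNReal.ofReal_le_ofReal (le_of_eq ?_))
    field_simp
  have hsub : {z : Fin n → Z | η * (1 + 2 * C) ≤ |cellMean c F n z k - m|} ⊆
      {z | η * (n * p) ≤ |∑ i, B.indicator F (z i) - n * ∫ w in B, F w ∂P|} ∪
      {z | η * (n * p) ≤ |∑ i, B.indicator (fun _ => (1 : ℝ)) (z i) -
        n * ∫ _ in B, (1 : ℝ) ∂P|} := by
    intro z hz
    by_contra hcon
    rw [Set.mem_union, not_or, Set.mem_ofPred_eq, Set.mem_ofPred_eq, not_le, not_le] at hcon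
    obtain ⟨h1, h2⟩ := hcon
    have hmean := abs_cellMean_le c hC hC0 n z k
    have hS : cellMean c F n z k * (∑ i, B.indicator (fun _ => (1 : ℝ)) (z i) + 1) =
        ∑ i, B.indicator F (z i) := by
      have hK : (0 : ℝ) ≤ ∑ i, if c (z i) = k then (1 : ℝ) else 0 :=
        Finset.sum_nonneg fun i _ => by split_ifs <;> norm_num
      simp only [Set.indicator_apply, hB, Set.mem_ofPred_eq, cellMean]
      exact div_mul_cancel₀ _ (by linarith)
    rw [← hm, ← hS] at h1
    simp only [integral_const, smul_eq_mul, mul_one, measureReal_restrict_apply_univ,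
      ← hp] at h2
    rw [Set.mem_ofPred_eq] at hz
    set K := ∑ i, B.indicator (fun _ => (1 : ℝ)) (z i)
    set a := cellMean c F n z k
    -- Here `a * (K + 1)` is the numerator of the mean, so the first bracket is its deviation; the
    -- second uses only `|a| ≤ C` and the deviation of the count. This gives the constant `1 + 2 *
    -- C`.
    have h3 : (a - m) * (n * p) = (a * (K + 1) - n * (m * p)) - a * ((K - n * p) + 1) := by ring
    have h4 : |a * ((K - n * p) + 1)| ≤ C * (η * (n * p) + η * (n * p)) := by
      rw [abs_mul]
      refine mul_le_mul hmean ?_ (abs_nonneg _) hC0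
      refine (abs_add_le _ _).trans ?_
      rw [abs_one]
      exact add_le_add h2.le hn
    have h5 : |a - m| * (n * p) < η * (1 + 2 * C) * (n * p) := by
      rw [← abs_of_pos hnp, ← abs_mul, abs_of_pos hnp, h3]
      refine (abs_sub _ _).trans_lt ?_
      calc _ < η * (n * p) + C * (η * (n * p) + η * (n * p)) := add_lt_add_of_lt_of_le h1 h4
        _ = _ := by ring
    exact absurd hz (not_le.2 (lt_of_mul_lt_mul_right h5 hnp.le))
  refine (measure_mono hsub).trans ((measure_union_le _ _).trans ?_)
  refine (add_le_add (hcheb F hF C hC) (hcheb _ measurable_const 1 (by simp))).trans ?_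
  rw [← ENNReal.ofReal_add (by positivity) (by positivity), ← add_div, one_pow]

/-! ### Cells with a small expected count are negligible. -/

/-- Outside a tail `|ψ| > R` there are at most `2R / h_n + 2` cells, and those in question have mass
below `|M| / n` each. Their total mass is of order `1 / (n h_n) + 1 / n`, which tends to `0`. -/
theorem tendsto_measure_cell_small {Z : Type*} [MeasurableSpace Z] (P : Measure Z)
    [IsProbabilityMeasure P] {ψ : Z → ℝ} (hψ : Measurable ψ) {h : ℕ → ℝ}
    (hh : IsBinWidthSequence h) (M : ℝ) :
    Tendsto (fun n : ℕ => P {w | n * P.real {w' | cellIndex (h n) (ψ w') =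
      cellIndex (h n) (ψ w)} < M}) atTop (𝓝 0) := by
  rw [ENNReal.tendsto_nhds_zero]
  intro δ hδ
  have htail : Tendsto (fun j : ℕ => P {w | (j : ℝ) < |ψ w|}) atTop (𝓝 0) := by
    have := tendsto_measure_iInter_atTop (μ := P) (s := fun j : ℕ => {w | (j : ℝ) < |ψ w|})
      (fun j => (measurableSet_lt measurable_const hψ.abs).nullMeasurableSet)
      (fun i j hij w (hw : (j : ℝ) < |ψ w|) => lt_of_le_of_lt (Nat.cast_le.2 hij) hw) ⟨0, measure_ne_top _ _⟩
    have hempty : ⋂ j : ℕ, {w | (j : ℝ) < |ψ w|} = ∅ := by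
      refine Set.eq_empty_of_forall_notMem fun w hw => ?_
      obtain ⟨j, hj⟩ := exists_nat_ge |ψ w|
      exact absurd (Set.mem_iInter.1 hw j) (not_lt.2 hj)
    rwa [hempty, measure_empty] at this
  obtain ⟨R, hR⟩ := (ENNReal.tendsto_nhds_zero.1 htail (δ / 2) (ENNReal.half_pos hδ.ne')).exists
  have hlim : Tendsto (fun n : ℕ => ENNReal.ofReal ((2 * R / h n + 2) * (|M| / n))) atTop
      (𝓝 0) := by
    have h1 : Tendsto (fun n : ℕ => 2 * R * |M| * ((n : ℝ) * h n)⁻¹ + 2 * |M| * (n : ℝ)⁻¹) atTop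
        (𝓝 (2 * R * |M| * 0 + 2 * |M| * 0)) :=
      (hh.tendsto_mul.inv_tendsto_atTop.const_mul _).add
        (tendsto_inv_atTop_nhds_zero_nat.const_mul _)
    simp only [mul_zero, add_zero] at h1
    have h2 := ENNReal.tendsto_ofReal h1
    rw [ENNReal.ofReal_zero] at h2
    refine h2.congr fun n => congrArg _ ?_
    rw [mul_inv]
    ring
  filter_upwards [ENNReal.tendsto_nhds_zero.1 hlim (δ / 2) (ENNReal.half_pos hδ.ne'),
    eventually_ge_atTop 1] with n hn hn1
  obtain ⟨e, he⟩ := hh.isPowerOfTwo n hn1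
  have hpos : 0 < h n := he ▸ zpow_pos two_pos e
  have hn0 : (0 : ℝ) < n := Nat.cast_pos.2 hn1
  set c : Z → ℤ := fun w => cellIndex (h n) (ψ w) with hc
  set T := (Finset.Icc ⌊-R / h n⌋ ⌊R / h n⌋).filter fun k => n * P.real {w | c w = k} < M with hT
  have hsub : {w | n * P.real {w' | c w' = c w} < M} ⊆
      {w | (R : ℝ) < |ψ w|} ∪ ⋃ k ∈ T, {w | c w = k} := by
    intro w hw
    by_cases hwR : (R : ℝ) < |ψ w|
    · exact Or.inl hwR
    · refine Or.inr (Set.mem_biUnion (x := c w) ?_ rfl)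
      rw [Finset.mem_coe, hT, Finset.mem_filter, Finset.mem_Icc]
      have := abs_le.1 (not_lt.1 hwR)
      exact ⟨⟨Int.floor_mono (by gcongr; exact this.1), Int.floor_mono (by gcongr; exact this.2)⟩,
        hw⟩
  have hcard : (T.card : ℝ) ≤ 2 * R / h n + 2 := by
    have h1 : (T.card : ℝ) ≤ ((⌊(R : ℝ) / h n⌋ + 1 - ⌊-(R : ℝ) / h n⌋).toNat : ℝ) := by
      rw [← Int.card_Icc]
      exact Nat.cast_le.2 (Finset.card_filter_le _ _)
    have h2 : ⌊-(R : ℝ) / h n⌋ ≤ ⌊(R : ℝ) / h n⌋ := by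
      refine Int.floor_mono ?_
      gcongr
      have : (0 : ℝ) ≤ R := Nat.cast_nonneg R
      linarith
    have h3 : (((⌊(R : ℝ) / h n⌋ + 1 - ⌊-(R : ℝ) / h n⌋).toNat : ℤ) : ℝ) =
        ⌊(R : ℝ) / h n⌋ + 1 - ⌊-(R : ℝ) / h n⌋ := by
      rw [Int.toNat_of_nonneg (by linarith)]
      push_cast
      ring
    rw [Int.cast_natCast] at h3
    rw [h3] at h1
    have h4 := Int.floor_le ((R : ℝ) / h n)
    have h5 := Int.lt_floor_add_one (-(R : ℝ) / h n)
    have h6 : 2 * R / h n = (R : ℝ) / h n - -(R : ℝ) / h n := by ring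
    linarith
  have hunion : P (⋃ k ∈ T, {w | c w = k}) ≤ δ / 2 := by
    refine (measure_biUnion_finset_le _ _).trans (le_trans ?_ hn)
    calc ∑ k ∈ T, P {w | c w = k} ≤ ∑ k ∈ T, ENNReal.ofReal (|M| / n) := by
          refine Finset.sum_le_sum fun k hk => ?_
          rw [← ofReal_measureReal]
          refine ENNReal.ofReal_le_ofReal ?_
          rw [le_div_iff₀ hn0, mul_comm]
          exact (Finset.mem_filter.1 hk).2.le.trans (le_abs_self M)
      _ = ENNReal.ofReal (T.card * (|M| / n)) := by
          rw [Finset.sum_const, nsmul_eq_mul, ENNReal.ofReal_mul (Nat.cast_nonneg _),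
            ENNReal.ofReal_natCast]
      _ ≤ _ := ENNReal.ofReal_le_ofReal (by gcongr)
  calc _ ≤ P ({w | (R : ℝ) < |ψ w|} ∪ ⋃ k ∈ T, {w | c w = k}) := measure_mono hsub
    _ ≤ δ / 2 + δ / 2 := (measure_union_le _ _).trans (add_le_add hR hunion)
    _ = δ := ENNReal.add_halves δ

/-! ### Nested partitions and martingale convergence. -/

/-- The ratio of two widths is a power of `2`, so the finer cell determines the coarser one. Without
this the cell σ-algebras need not form a filtration. -/
theorem exists_cellIndex_eq_ediv {h : ℕ → ℝ} (hh : IsBinWidthSequence h) {m n : ℕ} (hm : 1 ≤ m)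
    (hmn : m ≤ n) : ∃ d : ℕ, ∀ x, cellIndex (h m) x = cellIndex (h n) x / d := by
  obtain ⟨a, ha⟩ := hh.isPowerOfTwo m hm
  obtain ⟨b, hb⟩ := hh.isPowerOfTwo n (hm.trans hmn)
  have hle : h n ≤ h m := hh.antitone hm (hm.trans hmn) hmn
  rw [ha, hb, zpow_le_zpow_iff_right₀ one_lt_two] at hle
  obtain ⟨d, hd⟩ := Int.le.dest hle
  refine ⟨2 ^ d, fun x => ?_⟩
  rw [cellIndex, cellIndex, ← Int.floor_div_natCast, ha, hb, ← hd, zpow_add₀ two_ne_zero,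
    zpow_natCast, div_div]
  push_cast
  rfl

theorem tendsto_mul_cellIndex {h : ℕ → ℝ} (hh : IsBinWidthSequence h) (x : ℝ) :
    Tendsto (fun n => h n * cellIndex (h n) x) atTop (𝓝 x) := by
  have h1 : Tendsto (fun n => x - h n) atTop (𝓝 x) := by
    simpa using hh.tendsto_zero.const_sub x
  refine tendsto_of_tendsto_of_tendsto_of_le_of_le' h1 tendsto_const_nhds ?_ ?_ <;>
  filter_upwards [eventually_ge_atTop 1] with n hn <;>
  obtain ⟨e, he⟩ := hh.isPowerOfTwo n hn <;>
  have hpos : 0 < h n := he ▸ zpow_pos two_pos e <;>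
  have hmem := (cellIndex_eq_iff hpos x _).1 rfl
  · linarith [hmem.2]
  · linarith [hmem.1]

/-- The σ-algebras generated by the histogram cells. -/
def cellFiltration {Z : Type*} [MeasurableSpace Z] {ψ : Z → ℝ} (hψ : Measurable ψ) {h : ℕ → ℝ}
    (hh : IsBinWidthSequence h) : Filtration ℕ (inferInstance : MeasurableSpace Z) where
  -- The shift avoids `h 0`, which need not be a power of `2`.
  seq n := MeasurableSpace.comap (fun w => cellIndex (h (n + 1)) (ψ w)) inferInstance
  mono' m n hmn := by
    obtain ⟨d, hd⟩ := exists_cellIndex_eq_ediv hh (Nat.le_add_left 1 m)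
      (Nat.add_le_add_right hmn 1)
    simp only [hd]
    exact (Measurable.comp (g := fun k : ℤ => k / (d : ℤ)) measurable_from_top
      (comap_measurable _)).comap_le
  le' n := ((measurable_cellIndex _).comp hψ).comap_le

/-- The left endpoints of the cells converge to `ψ`, so `ψ` is measurable for the limit σ-algebra.
-/
theorem iSup_cellFiltration {Z : Type*} [MeasurableSpace Z] {ψ : Z → ℝ} (hψ : Measurable ψ)
    {h : ℕ → ℝ} (hh : IsBinWidthSequence h) :
    ⨆ n, cellFiltration hψ hh n = MeasurableSpace.comap ψ inferInstance := by
  refine le_antisymm (iSup_le fun n => ?_) ?_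
  · exact ((measurable_cellIndex _).comp (comap_measurable ψ)).comap_le
  · refine Measurable.comap_le (m₁ := ⨆ n, cellFiltration hψ hh n) ?_
    refine @measurable_of_tendsto_metrizable _ _ (⨆ n, cellFiltration hψ hh n) _ _ _ _
      (fun n w => h (n + 1) * cellIndex (h (n + 1)) (ψ w)) _ (fun n => ?_) ?_
    · have h1 : Measurable[⨆ n, cellFiltration hψ hh n] fun w => cellIndex (h (n + 1)) (ψ w) :=
        Measurable.mono (comap_measurable _) (le_iSup (fun n => cellFiltration hψ hh n) n) le_rfl
      exact (Measurable.comp (g := fun k : ℤ => h (n + 1) * (k : ℝ)) measurable_from_top h1)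
    · exact tendsto_pi_nhds.2 fun w =>
        (tendsto_mul_cellIndex hh (ψ w)).comp (tendsto_add_atTop_nat 1)

theorem tendsto_measure_condExp_cell_sub {Z : Type*} [MeasurableSpace Z] (P : Measure Z)
    [IsProbabilityMeasure P] {ψ : Z → ℝ} (hψ : Measurable ψ) {h : ℕ → ℝ}
    (hh : IsBinWidthSequence h) (F : Z → ℝ) {ε : ℝ} (hε : 0 < ε) :
    Tendsto (fun n => P {w | ε ≤
      |(P[F | MeasurableSpace.comap (fun w => cellIndex (h n) (ψ w)) inferInstance]) w -
        (P[F | MeasurableSpace.comap ψ inferInstance]) w|}) atTop (𝓝 0) := by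
  rw [← tendsto_add_atTop_iff_nat 1]
  have h1 := tendsto_ae_condExp (μ := P) (ℱ := cellFiltration hψ hh) F
  rw [iSup_cellFiltration] at h1
  have h2 := tendstoInMeasure_of_tendsto_ae
    (fun n => (stronglyMeasurable_condExp.mono
      ((cellFiltration hψ hh).le n)).aestronglyMeasurable) h1
  exact tendstoInMeasure_iff_dist.1 h2 ε hε

/-! ### Universal consistency. -/

theorem jointLaw_abs_cellMean_sub_condExp_ge_le {X : Type*} [MeasurableSpace X]
    (P : Measure (X × ℝ)) [IsProbabilityMeasure P] {c : X × ℝ → ℤ} (hc : Measurable c)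
    {F : X × ℝ → ℝ} (hF : Measurable F) {C : ℝ} (hC : ∀ w, |F w| ≤ C) (hC0 : 0 ≤ C) (n : ℕ)
    {η M : ℝ} (hη : 0 < η) (hM : 1 ≤ η * M) :
    jointLaw P n {p | η * (1 + 2 * C) ≤ |cellMean c F n p.1 (c p.2.1) -
      (P[F | MeasurableSpace.comap c inferInstance]) p.2.1|} ≤
      P {w | n * P.real {w' | c w' = c w} < M} +
        ENNReal.ofReal ((C ^ 2 + 1) / (η ^ 2 * M)) := by
  have hM0 : 0 < M := pos_of_mul_pos_right (one_pos.trans_le hM) hη.le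
  -- The conditional expectation given the cell factors as `g ∘ c`; integrating over the cell `k`
  -- shows that `g k` is an admissible centre `m` for the concentration bound.
  obtain ⟨g, -, hg⟩ := Measurable.exists_eq_measurable_comp (f := c)
    (stronglyMeasurable_condExp (μ := P) (f := F)
      (m := MeasurableSpace.comap c inferInstance)).measurable
  have hFint : Integrable F P :=
    Integrable.of_bound hF.aestronglyMeasurable C (ae_of_all _ hC)
  have hgk : ∀ k, g k * P.real {w | c w = k} = ∫ w in {w | c w = k}, F w ∂P := fun k => by
    have hk : MeasurableSet[MeasurableSpace.comap c inferInstance] {w | c w = k} :=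
      ⟨{k}, measurableSet_singleton k, rfl⟩
    rw [← setIntegral_condExp hc.comap_le hFint hk, hg,
      setIntegral_congr_fun (g := fun _ => g k) (hc.comap_le _ hk)
        (fun w (hw : c w = k) => by simp [hw]),
      setIntegral_const, smul_eq_mul, mul_comm]
  rw [hg]
  set S : ℤ → Set (Fin n → X × ℝ) := fun k =>
    {z | M ≤ n * P.real {w | c w = k} ∧ η * (1 + 2 * C) ≤ |cellMean c F n z k - g k|} with hS
  have hSm : ∀ k, MeasurableSet (S k) := fun k =>
    (MeasurableSet.const _).inter (measurableSet_le measurable_const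
      ((measurable_cellMean hc hF n k).sub_const _).abs)
  set T : Set ((Fin n → X × ℝ) × (X × ℝ) × unitInterval) := {p | p.1 ∈ S (c p.2.1)} with hT
  have hTm : MeasurableSet T := by
    have : T = ⋃ k, S k ×ˢ {q : (X × ℝ) × unitInterval | c q.1 = k} := by
      ext p
      simp [hT]
    rw [this]
    exact MeasurableSet.iUnion fun k => (hSm k).prod
      (measurableSet_eq_fun (hc.comp measurable_fst) measurable_const)
  have hsub : {p : (Fin n → X × ℝ) × (X × ℝ) × unitInterval |
      η * (1 + 2 * C) ≤ |cellMean c F n p.1 (c p.2.1) - (g ∘ c) p.2.1|} ⊆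
      (fun p => p.2.1) ⁻¹' {w | n * P.real {w' | c w' = c w} < M} ∪ T := by
    intro p hp
    rcases lt_or_ge (n * P.real {w' | c w' = c p.2.1}) M with h | h
    · exact Or.inl h
    · exact Or.inr ⟨h, hp⟩
  refine (measure_mono hsub).trans ((measure_union_le _ _).trans (add_le_add ?_ ?_))
  · have hmp : MeasurePreserving
        (fun p : (Fin n → X × ℝ) × (X × ℝ) × unitInterval => p.2.1) (jointLaw P n) P :=
      measurePreserving_fst.comp measurePreserving_snd
    have hbad : MeasurableSet {w | n * P.real {w' | c w' = c w} < M} :=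
      (measurable_from_top (f := fun k : ℤ => n * P.real {w' | c w' = k})).comp hc measurableSet_Iio
    exact (hmp.measure_preimage hbad.nullMeasurableSet).le
  -- With the test observation fixed, its cell is fixed, and the bound applies to the independent
  -- training sample.
  · rw [jointLaw, Measure.prod_apply_symm hTm]
    calc _ ≤ ∫⁻ _, ENNReal.ofReal ((C ^ 2 + 1) / (η ^ 2 * M))
          ∂(P.prod (volume : Measure unitInterval)) := by
          refine lintegral_mono fun q => ?_
          change (Measure.pi fun _ : Fin n => P) (S (c q.1)) ≤ _
          by_cases h : M ≤ n * P.real {w | c w = c q.1}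
          · refine (measure_mono fun z hz => hz.2).trans
              ((measure_abs_cellMean_sub_ge_le P hc hF hC hC0 hη (hgk _)
                (hM.trans (by gcongr))).trans (ENNReal.ofReal_le_ofReal (by gcongr)))
          · have : S (c q.1) = ∅ := Set.eq_empty_of_forall_notMem fun z hz => h hz.1
            simp [this]
      _ = _ := by simp

theorem integral_predictiveMeasure_histogramSystem_eq_cellMean {X : Type*} (φ : X → ℝ)
    (h : ℕ → ℝ) (n : ℕ) (z : Fin n → X × ℝ) (x : X) (τ : unitInterval) (f : ℝ → ℝ) :
    ∫ y, f y ∂(predictiveMeasure fun y => histogramSystem φ h n z (x, y) τ) =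
      cellMean (fun w : X × ℝ => cellIndex (h n) (φ w.1)) (fun w => f w.2) n z
        (cellIndex (h n) (φ x)) := by
  rw [integral_predictiveMeasure_histogramSystem, cellMean, trainingCell, Finset.sum_filter,
    Finset.card_filter]
  push_cast
  rfl

theorem isUniversallyConsistent_histogramSystem {X : Type*} [MeasurableSpace X] {φ : X → ℝ}
    (hφ : MeasurableEmbedding φ) {h : ℕ → ℝ} (hh : IsBinWidthSequence h) :
    IsUniversallyConsistent (histogramSystem φ h) := by
  intro P hP f hf ⟨C, hC⟩ ε hε
  have hC0 : 0 ≤ C := (abs_nonneg _).trans (hC 0)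
  have hψ : Measurable fun w : X × ℝ => φ w.1 := hφ.measurable.comp measurable_fst
  have hF : Measurable fun w : X × ℝ => f w.2 := hf.measurable.comp measurable_snd
  -- Being an embedding, `φ` loses no information: conditioning on `φ x` is conditioning on `x`.
  have hcomap : MeasurableSpace.comap (fun w : X × ℝ => φ w.1) inferInstance =
      MeasurableSpace.comap Prod.fst inferInstance := by
    rw [← hφ.comap_eq, MeasurableSpace.comap_comp]
    rfl
  simp only [integral_predictiveMeasure_histogramSystem_eq_cellMean, ← hcomap]
  set η := ε / 2 / (1 + 2 * C) with hη
  have hη0 : 0 < η := by positivity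
  have hηε : η * (1 + 2 * C) = ε / 2 := div_mul_cancel₀ _ (by positivity)
  rw [ENNReal.tendsto_nhds_zero]
  intro δ hδ
  have hδ3 : 0 < δ / 3 := ENNReal.div_pos hδ.ne' (by simp)
  have hM : Tendsto (fun M : ℝ => ENNReal.ofReal ((C ^ 2 + 1) / (η ^ 2 * M))) atTop (𝓝 0) := by
    rw [← ENNReal.ofReal_zero]
    exact ENNReal.tendsto_ofReal
      (tendsto_const_nhds.div_atTop (tendsto_id.const_mul_atTop (by positivity)))
  -- The threshold `M` is fixed before `n`, which is possible because the concentration bound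
  -- depends on `n` only through `M`.
  obtain ⟨M, hM1, hM2⟩ := ((ENNReal.tendsto_nhds_zero.1 hM _ hδ3).and
    ((tendsto_id.const_mul_atTop hη0).eventually_ge_atTop 1)).exists
  filter_upwards [ENNReal.tendsto_nhds_zero.1 (tendsto_measure_cell_small P hψ hh M) _ hδ3,
    ENNReal.tendsto_nhds_zero.1 (tendsto_measure_condExp_cell_sub P hψ hh (fun w => f w.2)
      (half_pos hε)) _ hδ3] with n hn1 hn2
  set c : X × ℝ → ℤ := fun w => cellIndex (h n) (φ w.1)
  have hc : Measurable c := (measurable_cellIndex _).comp hψ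
  have h1 := jointLaw_abs_cellMean_sub_condExp_ge_le P hc hF (fun w => hC w.2) hC0 n hη0 hM2
  rw [hηε] at h1
  have hmp : MeasurePreserving
      (fun p : (Fin n → X × ℝ) × (X × ℝ) × unitInterval => p.2.1) (jointLaw P n) P :=
    measurePreserving_fst.comp measurePreserving_snd
  have hmeas : MeasurableSet {w | ε / 2 ≤
      |(P[fun w => f w.2 | MeasurableSpace.comap c inferInstance]) w -
        (P[fun w => f w.2 | MeasurableSpace.comap (fun w => φ w.1) inferInstance]) w|} :=
    measurableSet_le measurable_const
      ((stronglyMeasurable_condExp.mono hc.comap_le).measurable.sub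
        (stronglyMeasurable_condExp.mono hψ.comap_le).measurable).abs
  rw [← hmp.measure_preimage hmeas.nullMeasurableSet] at hn2
  refine le_trans (measure_mono ?_) ((measure_union_le _ _).trans
    ((add_le_add (h1.trans (add_le_add hn1 hM1)) hn2).trans_eq (ENNReal.add_thirds δ)))
  intro p hp
  by_contra hcon
  rw [Set.mem_union, not_or] at hcon
  have h2 := not_le.1 (show ¬ε / 2 ≤ _ from hcon.1)
  have h3 := not_le.1 (show ¬ε / 2 ≤ _ from hcon.2)
  refine absurd (show ε ≤ _ from hp) (not_le.2 ?_)
  refine (abs_sub_le _ _ _).trans_lt ((add_lt_add h2 h3).trans_eq (add_halves ε))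

/-! ### Existence of admissible bin widths. -/

/-- The witness is a dyadic version of `n ^ (-1/2)`: with `k = Nat.log 2 n / 2`, the width is `2 ^
(-k)`, and `n ≥ 2 ^ (2 * k)` gives `n * h n ≥ 2 ^ k`. -/
theorem exists_isBinWidthSequence : ∃ h : ℕ → ℝ, IsBinWidthSequence h := by
  have hdiv : Tendsto (fun n => Nat.log 2 n / 2) atTop atTop :=
    tendsto_atTop_atTop.2 fun b => ⟨2 ^ (b * 2), fun n hn =>
      (Nat.le_div_iff_mul_le two_pos).2 (Nat.le_log_of_pow_le one_lt_two hn)⟩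
  refine ⟨fun n => (2 : ℝ) ^ (-((Nat.log 2 n / 2 : ℕ) : ℤ)), fun n _ => ⟨_, rfl⟩, ?_, ?_, ?_⟩
  · intro m _ n _ hmn
    refine zpow_le_zpow_right₀ one_le_two (neg_le_neg (Int.ofNat_le.2 ?_))
    exact Nat.div_le_div_right (Nat.log_mono_right hmn)
  · simp only [zpow_neg, zpow_natCast]
    exact ((tendsto_pow_atTop_atTop_of_one_lt one_lt_two).comp hdiv).inv_tendsto_atTop
  · refine tendsto_atTop_mono' _ ?_ ((tendsto_pow_atTop_atTop_of_one_lt one_lt_two).comp hdiv)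
    filter_upwards [eventually_ge_atTop 1] with n hn
    rw [zpow_neg, zpow_natCast, ← div_eq_mul_inv, le_div_iff₀ (by positivity),
      Function.comp_apply, ← pow_add]
    calc (2 : ℝ) ^ (Nat.log 2 n / 2 + Nat.log 2 n / 2) ≤ 2 ^ Nat.log 2 n :=
          pow_le_pow_right₀ one_le_two (by omega)
      _ ≤ n := by exact_mod_cast Nat.pow_log_le_self 2 (Nat.one_le_iff_ne_zero.1 hn)

end

end PredictiveSystems

theorem mainTheorem2 {X : Type*} [MeasurableSpace X] [StandardBorelSpace X] :
    (∃ Q : PredictiveSystems.PredictiveFunction X,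
      PredictiveSystems.IsMondrianPredictiveSystem Q ∧
        PredictiveSystems.IsUniversallyConsistent Q) ∧
    ∀ φ : X → ℝ, MeasurableEmbedding φ →
      ∀ h : ℕ → ℝ, PredictiveSystems.IsBinWidthSequence h →
        PredictiveSystems.IsMondrianPredictiveSystem (PredictiveSystems.histogramSystem φ h) ∧
          PredictiveSystems.IsUniversallyConsistent (PredictiveSystems.histogramSystem φ h) := by
  have key : ∀ φ : X → ℝ, MeasurableEmbedding φ →
      ∀ h : ℕ → ℝ, PredictiveSystems.IsBinWidthSequence h →
        PredictiveSystems.IsMondrianPredictiveSystem (PredictiveSystems.histogramSystem φ h) ∧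
          PredictiveSystems.IsUniversallyConsistent (PredictiveSystems.histogramSystem φ h) :=
    fun φ hφ h hh =>
      ⟨PredictiveSystems.isMondrianPredictiveSystem_histogramSystem h hφ.measurable,
        PredictiveSystems.isUniversallyConsistent_histogramSystem hφ hh⟩
  obtain ⟨φ, hφ⟩ := exists_measurableEmbedding_real X
  obtain ⟨h, hh⟩ := PredictiveSystems.exists_isBinWidthSequence
  exact ⟨⟨_, key φ hφ h hh⟩, key⟩
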